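/- Let $d\ge 2$ and let $A$ be a real $d\times d$ matrix such that, writing $L(\mathbf m)=A\mathbf m=(L_1(\mathbf m),\dots,L_d(\mathbf m))$ for $\mathbf m\in\mathbb Z^d$, (1) $\left|\prod_{j=1}^d L_j(\mathbf m)\right|\ge 1$ for all $\mathbf m\in\mathbb Z^d\setminus\{\mathbf 0\}$, and (2) each parallelepiped $P$ with edges parallel to the coordinate axes and volume $|P|$ contains at most $|P|+1$ points of the lattice $\{A\mathbf m:\mathbf m\in\mathbb Z^d\}$. (Such a matrix is invertible.) For $a>1$ and compactly supported $f:\mathbb R^d\to\mathbb R$ define the Frolov cubature formula $$\Phi(a,A)(f):=\bigl(a^d|\det A|\bigr)^{-1}\sum_{\mathbf m\in\mathbb Z^d} f\left(\frac{(A^{-1})^T\mathbf m}{a}\right).$$ For $u>0$ let $h^1(x,u)$ be the indicator function of $[-u/2,u/2)$ and, for integers $r\ge2$, let $h^r(\cdot,u):=h^{r-1}(\cdot,u)*h^1(\cdot,u)$; in particular $h^2(x,u)=\max(u-|x|,0)$. Let $\mathcal B$ be the set of boxes $B=[\mathbf x,\mathbf y)=\prod_{j=1}^d[x_j,y_j)$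 with $\mathbf x,\mathbf y\in[0,1)^d$ and $x_j<y_j$ for all $j$. Writing $B=\prod_{j=1}^d[x^0_j-ru_j/2,\;x^0_j+ru_j/2)$, set $$h^r_B(\mathbf x):=\prod_{j=1}^d h^r(x_j-x^0_j,u_j),\qquad \hat f(\mathbf y):=\int_{\mathbb R^d}f(\mathbf x)e^{-2\pi i(\mathbf y,\mathbf x)}\,d\mathbf x .$$ Theorem. Let $r\ge2$ be an integer. There exist constants $c=c(d,A,r)>0$ and $C=C(d,A,r)>0$ such that for every $a>1$, with $V_0:=c\,a^{-d}$, for every $V\ge V_0$ and every $B\in\mathcal B$ with $\mathrm{vol}(B)=V$, $$\left|\Phi(a,A)(h^r_B)-\hat h^r_B(\mathbf 0)\right|\le C\,a^{-rd}\,\bigl(\log(2V/V_0)\bigr)^{d-1}.$$ -/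

import Mathlib

open MeasureTheory
open scoped FourierTransform

namespace FrolovSmooth

/-- The linear map `L(m) = A m` on integer vectors. -/
def latticePoint {d : ℕ} (A : Matrix (Fin d) (Fin d) ℝ) (m : Fin d → ℤ) : Fin d → ℝ :=
  A.mulVec fun j => (m j : ℝ)

/-- The two properties of the Frolov matrix: `∏ |L_j(m)| ≥ 1` for all nonzero integer vectors `m`,
and each axis-parallel parallelepiped `P` contains at most `|P| + 1` points of the lattice.
(The first property already forces `A` to be invertible.) -/
structure IsFrolovMatrix {d : ℕ} (A : Matrix (Fin d) (Fin d) ℝ) : Prop where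
  one_le_abs_prod : ∀ m : Fin d → ℤ, m ≠ 0 → 1 ≤ |∏ j, latticePoint A m j|
  box_count : ∀ l u : Fin d → ℝ, (∀ j, l j < u j) →
    (Set.range (latticePoint A) ∩ Set.Icc l u).Finite ∧
      ((Set.range (latticePoint A) ∩ Set.Icc l u).ncard : ℝ) ≤ ∏ j, (u j - l j) + 1

/-- The Frolov cubature formula
`Φ(a, A)(f) = (a^d |det A|)⁻¹ ∑_{m ∈ ℤ^d} f ((A⁻¹)ᵀ m / a)`
(for compactly supported `f`, where the sum has finitely many nonzero terms). -/
noncomputable def cubature {d : ℕ} (a : ℝ) (A : Matrix (Fin d) (Fin d) ℝ)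
    (f : EuclideanSpace ℝ (Fin d) → ℝ) : ℝ :=
  (a ^ d * |A.det|)⁻¹ *
    ∑' m : Fin d → ℤ, f (WithLp.toLp 2 (a⁻¹ • (A⁻¹).transpose.mulVec fun j => (m j : ℝ)))

/-- The functions `h^r(·, u)`: `h^1(·, u)` is the indicator of `[-u/2, u/2)` and
`h^r(·, u) = h^{r-1}(·, u) ∗ h^1(·, u)` for `r ≥ 2`. The value at `r = 0` is not used. -/
noncomputable def hat : ℕ → ℝ → ℝ → ℝ
  | 0, _ => 0
  | 1, u => Set.indicator (Set.Ico (-(u / 2)) (u / 2)) 1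
  | n + 2, u => convolution (hat (n + 1) u) (Set.indicator (Set.Ico (-(u / 2)) (u / 2)) 1)
      (ContinuousLinearMap.mul ℝ ℝ) volume

/-- The half-open axis-parallel boxes `[lo, hi)` with `lo, hi ∈ [0,1)^d` and `lo < hi`
coordinatewise. -/
structure UnitBox (d : ℕ) where
  lo : Fin d → ℝ
  hi : Fin d → ℝ
  lo_nonneg : ∀ j, 0 ≤ lo j
  lo_lt_hi : ∀ j, lo j < hi j
  hi_lt_one : ∀ j, hi j < 1

/-- The box as a set of points. -/
def UnitBox.toSet {d : ℕ} (B : UnitBox d) : Set (Fin d → ℝ) :=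
  Set.univ.pi fun j => Set.Ico (B.lo j) (B.hi j)

/-- The volume of a box. -/
noncomputable def UnitBox.vol {d : ℕ} (B : UnitBox d) : ℝ := volume.real B.toSet

theorem UnitBox.vol_eq_prod {d : ℕ} (B : UnitBox d) : B.vol = ∏ j, (B.hi j - B.lo j) := by
  simp only [UnitBox.vol, UnitBox.toSet, Measure.real]
  rw [volume_pi_pi, ENNReal.toReal_prod]
  refine Finset.prod_congr rfl fun j _ => ?_
  rw [Real.volume_Ico, ENNReal.toReal_ofReal (sub_nonneg.2 (B.lo_lt_hi j).le)]

/-- For `B = ∏ [x⁰_j - r u_j / 2, x⁰_j + r u_j / 2)`, that is, `x⁰ = (lo + hi) / 2` and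
`u = (hi - lo) / r`, the function `h^r_B(x) = ∏ h^r(x_j - x⁰_j, u_j)`. -/
noncomputable def boxHat {d : ℕ} (r : ℕ) (B : UnitBox d) (x : EuclideanSpace ℝ (Fin d)) : ℝ :=
  ∏ j, hat r ((B.hi j - B.lo j) / r) (x j - (B.lo j + B.hi j) / 2)

end FrolovSmooth

/-! Poisson summation (`hasSum_cubature`) turns the cubature sum into the sum of the Fourier
transform of `boxHat` over the dilated lattice `a A ℤ^d`. The term at `0` is the integral, so the
error is the sum over `n ≠ 0`. Convolution becomes multiplication, so each factor of the transform
is at most `min u (1/(π|ξ|)) ^ r`. With `w j = a u_j` and `W = ∏ w j`, a factor `a^(-rd)` comes out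
and it remains to bound `∑ ∏ min (w j) (1/(π|L_j|)) ^ r`.

Sort the nonzero lattice points by the dyadic sizes `σ j` of `w j |L_j|`, and let `n = ∑ σ j`. A
term is at most `(W/2^n)^r`. The product property forces `W < 2^n`, and box counting gives at most
`2^d 2^n/W + 1` points for each `σ`. As `r ≥ 2`, one `σ` contributes `O(W/2^n)` (`sum_levels_le`).
At most `(n+1)^(d-1)` vectors `σ` have sum `n`, so the geometric decay beyond the first `n₀` with `W
< 2^n₀` leaves `O((n₀+1)^(d-1))` (`sum_prod_min_le`). Finally `n₀ + 1` is `O(log (2W))`, where `W =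
V/V₀`. -/

namespace FrolovSmooth

open UnitAddTorus

/-! ### Poisson summation on the integer lattice via the torus -/

section Poisson

variable {ι : Type*}

/-- The sum of all integer translates of a function. -/
noncomputable def periodize (g : (ι → ℝ) → ℂ) (x : ι → ℝ) : ℂ :=
  ∑' m : ι → ℤ, g (x + fun i => (m i : ℝ))

theorem periodize_add_int (g : (ι → ℝ) → ℂ) (x : ι → ℝ) (k : ι → ℤ) :
    periodize g (x + fun i => (k i : ℝ)) = periodize g x := by
  unfold periodize
  rw [← (Equiv.addLeft k).tsum_eq (fun m : ι → ℤ => g (x + fun i => (m i : ℝ)))]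
  refine tsum_congr fun m => congrArg g ?_
  funext i
  simp [add_assoc]

variable [Fintype ι]

/-- The integer vectors in a bounded region form a finite set. -/
theorem finite_int_mem_of_isBounded {K : Set (ι → ℝ)} (hK : Bornology.IsBounded K) :
    {m : ι → ℤ | (fun i => (m i : ℝ)) ∈ K}.Finite := by
  classical
  obtain ⟨R, hR⟩ := hK.exists_norm_le
  refine (Set.finite_Icc (fun _ : ι => -⌈R⌉) (fun _ => ⌈R⌉)).subset fun m hm => ?_
  have h (i : ι) : |(m i : ℝ)| ≤ (⌈R⌉ : ℝ) :=
    ((norm_le_pi_norm (fun i => (m i : ℝ)) i).trans (hR _ hm)).trans (Int.le_ceil R)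
  constructor <;> intro i
  · exact_mod_cast (abs_le.1 (h i)).1
  · exact_mod_cast (abs_le.1 (h i)).2

/-- The integer translates of a compactly supported function are locally finite; uniformly so on
bounded sets. -/
theorem finite_translates_inter {g : (ι → ℝ) → ℂ} (hs : HasCompactSupport g)
    {K : Set (ι → ℝ)} (hK : Bornology.IsBounded K) :
    {m : ι → ℤ | ∃ x ∈ K, g (x + fun i => (m i : ℝ)) ≠ 0}.Finite := by
  refine (finite_int_mem_of_isBounded (hs.isCompact.isBounded.sub hK)).subset ?_
  rintro m ⟨x, hx, hm⟩
  exact ⟨x + fun i => (m i : ℝ), subset_tsupport _ hm, x, hx, by simp⟩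

theorem continuous_periodize {g : (ι → ℝ) → ℂ} (hg : Continuous g) (hs : HasCompactSupport g) :
    Continuous (periodize g) := by
  have key : periodize g = fun x => ∑ᶠ m : ι → ℤ, g (x + fun i => (m i : ℝ)) := by
    funext x
    refine tsum_eq_finsum ?_
    refine (finite_translates_inter hs (K := {x}) Bornology.isBounded_singleton).subset ?_
    intro m hm
    exact ⟨x, rfl, hm⟩
  rw [key]
  refine continuous_finsum (fun m => by fun_prop) fun x => ?_
  refine ⟨Metric.ball x 1, Metric.ball_mem_nhds _ one_pos, ?_⟩
  refine (finite_translates_inter hs (K := Metric.ball x 1) Metric.isBounded_ball).subset ?_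
  rintro m ⟨y, hy, hy'⟩
  exact ⟨y, hy', hy⟩

/-- The periodization as a continuous function on the torus. -/
theorem exists_torus_periodize {g : (ι → ℝ) → ℂ} (hg : Continuous g) (hs : HasCompactSupport g) :
    ∃ F : C(UnitAddTorus ι, ℂ), ∀ x : ι → ℝ, F (fun i => (x i : UnitAddCircle)) = periodize g x := by
  have hq : IsOpenQuotientMap
      (Pi.map fun _ : ι => ((↑) : ℝ → UnitAddCircle)) :=
    IsOpenQuotientMap.piMap fun _ => QuotientAddGroup.isOpenQuotientMap_mk
  have hlift (x y : ι → ℝ) (h : Pi.map (fun _ : ι => ((↑) : ℝ → UnitAddCircle)) x =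
      Pi.map (fun _ : ι => ((↑) : ℝ → UnitAddCircle)) y) : periodize g x = periodize g y := by
    have h' (i : ι) : ∃ n : ℤ, y i = x i + n := by
      have := congrFun h i
      simp only [Pi.map_apply] at this
      rw [eq_comm, ← sub_eq_zero, ← AddCircle.coe_sub, AddCircle.coe_eq_zero_iff] at this
      obtain ⟨n, hn⟩ := this
      exact ⟨n, by rw [zsmul_one] at hn; linarith⟩
    choose n hn using h'
    rw [show y = x + fun i => (n i : ℝ) from funext hn, periodize_add_int]
  let p : C(ι → ℝ, UnitAddTorus ι) := ⟨_, hq.continuous⟩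
  have hp : Topology.IsQuotientMap p := hq.isQuotientMap
  exact ⟨hp.lift ⟨periodize g, continuous_periodize hg hs⟩ hlift, fun x => DFunLike.congr_fun
    (hp.lift_comp ⟨periodize g, continuous_periodize hg hs⟩ hlift) x⟩

/-- The half-open unit cube at an integer point. -/
def intCube (m : ι → ℤ) : Set (ι → ℝ) := {x | ∀ i, x i ∈ Set.Ioc (m i : ℝ) (m i + 1)}

theorem measurableSet_intCube (m : ι → ℤ) : MeasurableSet (intCube m) :=
  MeasurableSet.univ_pi' fun _ => measurableSet_Ioc

/-- The integer cubes tile space. They are open on the left and closed on the right to match the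
fundamental domain in `mFourierCoeff_eq_integral`. -/
theorem integral_eq_tsum_intCube {g : (ι → ℝ) → ℂ} (hg : Integrable g) :
    ∫ x, g x = ∑' m : ι → ℤ, ∫ x in intCube 0, g (x + fun i => (m i : ℝ)) := by
  have hun : (⋃ m : ι → ℤ, intCube m) = Set.univ := by
    refine Set.eq_univ_of_forall fun x => Set.mem_iUnion.2 ⟨fun i => ⌈x i⌉ - 1, fun i => ?_⟩
    push_cast
    exact ⟨by linarith [Int.ceil_lt_add_one (x i)], by linarith [Int.le_ceil (x i)]⟩
  have hdisj : Pairwise (Function.onFun Disjoint (intCube : (ι → ℤ) → Set (ι → ℝ))) := by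
    intro m n hmn
    refine Set.disjoint_left.2 fun x hm hn => hmn (funext fun i => ?_)
    have h1 : (m i : ℝ) < n i + 1 := (hm i).1.trans_le (hn i).2
    have h2 : (n i : ℝ) < m i + 1 := (hn i).1.trans_le (hm i).2
    have h1' : m i < n i + 1 := by exact_mod_cast h1
    have h2' : n i < m i + 1 := by exact_mod_cast h2
    omega
  rw [← setIntegral_univ, ← hun, integral_iUnion measurableSet_intCube hdisj hg.integrableOn]
  refine tsum_congr fun m => ?_
  rw [← (measurePreserving_add_right (volume : Measure (ι → ℝ))
    (fun i => (m i : ℝ))).setIntegral_preimage_emb (measurableEmbedding_addRight _)]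
  congr 2
  ext x
  simp only [intCube, Set.mem_preimage, Set.mem_ofPred_eq, Pi.add_apply, Set.mem_Ioc, Pi.zero_apply,
    Int.cast_zero]
  exact forall_congr' fun i => ⟨fun h => ⟨by linarith [h.1], by linarith [h.2]⟩,
    fun h => ⟨by linarith [h.1], by linarith [h.2]⟩⟩

theorem mFourier_coe (n : ι → ℤ) (x : ι → ℝ) :
    mFourier n (fun i => (x i : UnitAddCircle)) =
      Complex.exp (2 * Real.pi * Complex.I * ((∑ i, n i * x i : ℝ) : ℂ)) := by
  simp only [mFourier, ContinuousMap.coe_mk, fourier_coe_apply]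
  rw [← Complex.exp_sum]
  congr 1
  push_cast
  rw [Finset.mul_sum]
  exact Finset.sum_congr rfl fun i _ => by ring

/-- Unfolding: the Fourier coefficients of the periodization are values of the Fourier transform. -/
theorem mFourierCoeff_of_periodize {g : (ι → ℝ) → ℂ} (hg : Continuous g)
    (hs : HasCompactSupport g) {F : C(UnitAddTorus ι, ℂ)}
    (hF : ∀ x : ι → ℝ, F (fun i => (x i : UnitAddCircle)) = periodize g x) (n : ι → ℤ) :
    mFourierCoeff F n =
      ∫ x, Complex.exp (-(2 * Real.pi * Complex.I * ((∑ i, n i * x i : ℝ) : ℂ))) * g x := by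
  set e : (ι → ℝ) → ℂ :=
    fun x => Complex.exp (-(2 * Real.pi * Complex.I * ((∑ i, n i * x i : ℝ) : ℂ))) with he
  have hec : Continuous e := by fun_prop
  have heF (x : ι → ℝ) : mFourier (-n) (fun i => (x i : UnitAddCircle)) = e x := by
    rw [mFourier_coe, he]
    simp
  have heper (x : ι → ℝ) (m : ι → ℤ) : e (x + fun i => (m i : ℝ)) = e x := by
    rw [← heF, ← heF]
    congr 1
    funext i
    simp
  have hcube : Bornology.IsBounded (intCube (0 : ι → ℤ)) := by
    refine (Metric.isBounded_Icc (0 : ι → ℝ) 1).subset fun x hx => ?_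
    exact ⟨fun i => by simpa using (hx i).1.le, fun i => by simpa using (hx i).2⟩
  -- Only finitely many translates meet the unit cube, so exchanging sum and integral is a finite
  -- matter.
  have hfin := finite_translates_inter hs hcube
  set S := hfin.toFinset with hS
  have hzero (m : ι → ℤ) (hm : m ∉ S) (x : ι → ℝ) (hx : x ∈ intCube 0) :
      g (x + fun i => (m i : ℝ)) = 0 := by
    by_contra h
    exact hm (hfin.mem_toFinset.2 ⟨x, hx, h⟩)
  have hint : Integrable fun x => e x * g x :=
    (hec.mul hg).integrable_of_hasCompactSupport hs.mul_left
  change _ = ∫ x, e x * g x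
  rw [integral_eq_tsum_intCube hint, mFourierCoeff_eq_integral _ _ 0]
  have hset : {x : ι → ℝ | ∀ i, x i ∈ Set.Ioc ((0 : ι → ℝ) i) ((0 : ι → ℝ) i + 1)} = intCube 0 := by
    simp [intCube]
  rw [hset, tsum_eq_sum (s := S), ← integral_finsetSum]
  · refine setIntegral_congr_fun (measurableSet_intCube _) fun x hx => ?_
    simp only [heF, hF, smul_eq_mul, heper, periodize]
    rw [tsum_eq_sum (s := S) fun m hm => hzero m hm x hx, Finset.mul_sum]
  · intro m _
    exact (hint.comp_add_right _).integrableOn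
  · intro m hm
    refine setIntegral_eq_zero_of_forall_eq_zero fun x hx => ?_
    simp [hzero m hm x hx]

/-- **Poisson summation** over `ℤ^ι` for continuous compactly supported functions with summable
Fourier transform. -/
theorem hasSum_fourier_int {g : (ι → ℝ) → ℂ} (hg : Continuous g) (hs : HasCompactSupport g)
    (hsum : Summable fun n : ι → ℤ =>
      ∫ x, Complex.exp (-(2 * Real.pi * Complex.I * ((∑ i, n i * x i : ℝ) : ℂ))) * g x) :
    HasSum (fun n : ι → ℤ =>
      ∫ x, Complex.exp (-(2 * Real.pi * Complex.I * ((∑ i, n i * x i : ℝ) : ℂ))) * g x)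
      (∑' m : ι → ℤ, g fun i => (m i : ℝ)) := by
  obtain ⟨F, hF⟩ := exists_torus_periodize hg hs
  have hc := funext fun n => mFourierCoeff_of_periodize hg hs hF n
  rw [← hc] at hsum ⊢
  have h := hasSum_mFourier_series_apply_of_summable hsum (fun _ => ((0 : ℝ) : UnitAddCircle))
  rw [hF (fun _ => 0)] at h
  convert h using 1
  · funext n
    rw [mFourier_coe]
    simp
  · simp only [periodize]
    refine tsum_congr fun m => congrArg g ?_
    funext i
    simp

end Poisson

/-! ### One-dimensional hat functions and the decay of their Fourier transforms -/

section Hat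

theorem integrable_indicator_Ico_one (u : ℝ) :
    Integrable (Set.indicator (Set.Ico (-(u / 2)) (u / 2)) (1 : ℝ → ℝ)) := by
  refine IntegrableOn.integrable_indicator ?_ measurableSet_Ico
  exact integrableOn_const measure_Ico_lt_top.ne

theorem integrable_hat (n : ℕ) (u : ℝ) : Integrable (hat (n + 1) u) := by
  induction n with
  | zero => exact integrable_indicator_Ico_one u
  | succ n ih => exact ih.integrable_convolution _ (integrable_indicator_Ico_one u)

theorem hasCompactSupport_hat (n : ℕ) (u : ℝ) : HasCompactSupport (hat (n + 1) u) := by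
  have h1 : HasCompactSupport (Set.indicator (Set.Ico (-(u / 2)) (u / 2)) (1 : ℝ → ℝ)) :=
    HasCompactSupport.intro isCompact_Icc fun x hx =>
      Set.indicator_of_notMem (fun h => hx (Set.Ico_subset_Icc_self h)) _
  induction n with
  | zero => exact h1
  | succ n ih => exact ih.convolution _ h1

/-- Convolving with the indicator integrates over a sliding window; the reflection `t ↦ x - t` turns
`Ico` into `Ioc`, the convention of interval integrals. -/
theorem hat_eq_intervalIntegral (n : ℕ) {u : ℝ} (hu : 0 < u) (x : ℝ) :
    hat (n + 2) u x = ∫ t in (x - u / 2)..(x + u / 2), hat (n + 1) u t := by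
  rw [intervalIntegral.integral_of_le (by linarith), ← integral_indicator measurableSet_Ioc]
  change ∫ t, _ = _
  refine integral_congr_ae (Filter.Eventually.of_forall fun t => ?_)
  simp only [ContinuousLinearMap.mul_apply', Set.indicator_apply, Set.mem_Ico, Set.mem_Ioc,
    Pi.one_apply]
  have : (-(u / 2) ≤ x - t ∧ x - t < u / 2) ↔ (x - u / 2 < t ∧ t ≤ x + u / 2) := by
    constructor <;> rintro ⟨_, _⟩ <;> constructor <;> linarith
  rw [if_congr this rfl rfl, mul_ite, mul_one, mul_zero]

/-- Primitives of integrable functions are continuous, so the jumps of `hat 1` do no harm. -/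
theorem continuous_hat (n : ℕ) {u : ℝ} (hu : 0 < u) : Continuous (hat (n + 2) u) := by
  have hi (a b : ℝ) : IntervalIntegrable (hat (n + 1) u) volume a b :=
    (integrable_hat n u).intervalIntegrable
  have h : hat (n + 2) u = fun x => (∫ t in (0 : ℝ)..(x + u / 2), hat (n + 1) u t) -
      ∫ t in (0 : ℝ)..(x - u / 2), hat (n + 1) u t := by
    funext x
    rw [hat_eq_intervalIntegral n hu, intervalIntegral.integral_interval_sub_left (hi _ _) (hi _ _)]
  rw [h]
  have hc := intervalIntegral.continuous_primitive hi 0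
  exact (hc.comp (by fun_prop : Continuous fun x : ℝ => x + u / 2)).sub
    (hc.comp (by fun_prop : Continuous fun x : ℝ => x - u / 2))

theorem fourier_hat (n : ℕ) (u ξ : ℝ) :
    𝓕 (fun t => (hat (n + 1) u t : ℂ)) ξ = 𝓕 (fun t => (hat 1 u t : ℂ)) ξ ^ (n + 1) := by
  induction n with
  | zero => simp
  | succ n ih =>
    have h : (fun t => (hat (n + 2) u t : ℂ)) =
        convolution (fun t => (hat (n + 1) u t : ℂ)) (fun t => (hat 1 u t : ℂ))
          (ContinuousLinearMap.mul ℂ ℂ) volume := by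
      funext t
      change ((∫ s, _ : ℝ) : ℂ) = ∫ s, _
      rw [← integral_complex_ofReal]
      simp [hat]
    rw [h, Real.fourier_mul_convolution_eq (f₁ := fun t => (hat (n + 1) u t : ℂ))
      (f₂ := fun t => (hat 1 u t : ℂ)) (integrable_hat n u).ofReal (integrable_hat 0 u).ofReal,
      ih, pow_succ _ (n + 1)]

theorem fourier_hat_one {u : ℝ} (hu : 0 < u) (ξ : ℝ) :
    𝓕 (fun t => (hat 1 u t : ℂ)) ξ =
      ∫ t in (-(u / 2))..(u / 2), Complex.exp ((-(2 * Real.pi * ξ) * Complex.I) * t) := by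
  rw [Real.fourier_real_eq_integral_exp_smul, intervalIntegral.integral_of_le (by linarith),
    ← integral_Ico_eq_integral_Ioc, ← integral_indicator measurableSet_Ico]
  congr 1
  funext t
  simp only [hat, Set.indicator_apply]
  split_ifs
  · simp only [Pi.one_apply, Complex.ofReal_one, smul_eq_mul, mul_one]
    congr 1
    push_cast
    ring
  · simp

theorem norm_fourier_hat_one_le {u : ℝ} (hu : 0 < u) (ξ : ℝ) :
    ‖𝓕 (fun t => (hat 1 u t : ℂ)) ξ‖ ≤ u := by
  rw [fourier_hat_one hu]
  refine (intervalIntegral.norm_integral_le_of_norm_le_const (C := 1) fun t _ => ?_).trans ?_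
  · have : (-(2 * Real.pi * ξ) * Complex.I) * t = ((-(2 * Real.pi * ξ) * t : ℝ) : ℂ) * Complex.I := by
      push_cast
      ring
    rw [this, Complex.norm_exp_ofReal_mul_I]
  · rw [show u / 2 - -(u / 2) = u by ring, abs_of_pos hu, one_mul]

theorem norm_fourier_hat_one_le_inv {u : ℝ} (hu : 0 < u) {ξ : ℝ} (hξ : ξ ≠ 0) :
    ‖𝓕 (fun t => (hat 1 u t : ℂ)) ξ‖ ≤ (Real.pi * |ξ|)⁻¹ := by
  have hc : (-(2 * Real.pi * ξ) * Complex.I : ℂ) ≠ 0 := by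
    simp [Real.pi_ne_zero, hξ]
  have hn (t : ℝ) : ‖Complex.exp ((-(2 * Real.pi * ξ) * Complex.I) * t)‖ = 1 := by
    have : (-(2 * Real.pi * ξ) * Complex.I) * t = ((-(2 * Real.pi * ξ) * t : ℝ) : ℂ) * Complex.I := by
      push_cast
      ring
    rw [this, Complex.norm_exp_ofReal_mul_I]
  rw [fourier_hat_one hu, integral_exp_mul_complex hc, norm_div]
  have h2 : ‖(-(2 * Real.pi * ξ) * Complex.I : ℂ)‖ = 2 * (Real.pi * |ξ|) := by
    simp [abs_of_pos Real.pi_pos, mul_assoc]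
  rw [h2]
  have h3 : 0 < Real.pi * |ξ| := mul_pos Real.pi_pos (abs_pos.2 hξ)
  rw [div_le_iff₀ (by positivity), show (Real.pi * |ξ|)⁻¹ * (2 * (Real.pi * |ξ|)) = 1 + 1 by
    field_simp; norm_num]
  exact (norm_sub_le _ _).trans (by rw [hn, hn])

theorem norm_fourier_hat_le {r : ℕ} (hr : 1 ≤ r) {u : ℝ} (hu : 0 < u) {ξ : ℝ} (hξ : ξ ≠ 0) :
    ‖𝓕 (fun t => (hat r u t : ℂ)) ξ‖ ≤ min u (Real.pi * |ξ|)⁻¹ ^ r := by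
  obtain ⟨n, rfl⟩ := Nat.exists_eq_add_of_le' hr
  rw [fourier_hat, norm_pow]
  exact pow_le_pow_left₀ (norm_nonneg _)
    (le_min (norm_fourier_hat_one_le hu ξ) (norm_fourier_hat_one_le_inv hu hξ)) _

end Hat

/-! ### Tensor products of hats over a box -/

section Box

variable {d : ℕ}

theorem continuous_boxHat {r : ℕ} (hr : 2 ≤ r) (B : UnitBox d) : Continuous (boxHat r B) := by
  obtain ⟨n, rfl⟩ := Nat.exists_eq_add_of_le' hr
  unfold boxHat
  refine continuous_finsetProd _ fun j _ => (continuous_hat n ?_).comp (by fun_prop)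
  exact div_pos (sub_pos.2 (B.lo_lt_hi j)) (by positivity)

theorem hasCompactSupport_boxHat_toLp {r : ℕ} (hr : 1 ≤ r) (B : UnitBox d) :
    HasCompactSupport fun x : Fin d → ℝ => boxHat r B (WithLp.toLp 2 x) := by
  obtain ⟨n, rfl⟩ := Nat.exists_eq_add_of_le' hr
  have h (j : Fin d) := (hasCompactSupport_hat n ((B.hi j - B.lo j) / (n + 1 : ℕ))).comp_homeomorph
    (Homeomorph.subRight ((B.lo j + B.hi j) / 2))
  refine HasCompactSupport.intro (isCompact_univ_pi fun j => (h j).isCompact) fun x hx => ?_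
  simp only [Set.mem_univ_pi, not_forall] at hx
  obtain ⟨j, hj⟩ := hx
  have h0 := image_eq_zero_of_notMem_tsupport hj
  exact Finset.prod_eq_zero (Finset.mem_univ j) h0

theorem fourier_boxHat_zero (r : ℕ) (B : UnitBox d) :
    𝓕 (fun x : EuclideanSpace ℝ (Fin d) => (boxHat r B x : ℂ)) 0 =
      ∫ x : Fin d → ℝ, (boxHat r B (WithLp.toLp 2 x) : ℂ) := by
  rw [Real.fourier_eq]
  simp only [inner_zero_right, neg_zero, AddChar.map_zero_eq_one, one_smul]
  exact ((PiLp.volume_preserving_toLp (Fin d)).integral_comp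
    (MeasurableEquiv.toLp 2 (Fin d → ℝ)).measurableEmbedding _).symm

theorem integral_exp_mul_boxHat (r : ℕ) (B : UnitBox d) (ξ : Fin d → ℝ) :
    ∫ x : Fin d → ℝ, Complex.exp (-(2 * Real.pi * Complex.I * ((∑ i, ξ i * x i : ℝ) : ℂ))) *
        (boxHat r B (WithLp.toLp 2 x) : ℂ) =
      ∏ j, ∫ t : ℝ, Complex.exp (-(2 * Real.pi * Complex.I * (ξ j * t))) *
        (hat r ((B.hi j - B.lo j) / r) (t - (B.lo j + B.hi j) / 2) : ℂ) := by
  rw [← integral_fintype_prod_volume_eq_prod]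
  congr 1
  funext x
  rw [Finset.prod_mul_distrib, ← Complex.exp_sum, boxHat]
  congr 2
  · push_cast
    rw [Finset.mul_sum, Finset.sum_neg_distrib]
  · push_cast
    rfl

/-- Translation only contributes a unimodular phase, so the centre of the box plays no role in the
bounds. -/
theorem norm_integral_exp_mul_translate (f : ℝ → ℂ) (ξ b : ℝ) :
    ‖∫ t : ℝ, Complex.exp (-(2 * Real.pi * Complex.I * (ξ * t))) * f (t - b)‖ = ‖𝓕 f ξ‖ := by
  have h : (∫ t : ℝ, Complex.exp (-(2 * Real.pi * Complex.I * (ξ * t))) * f (t - b)) =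
      Complex.exp ((-(2 * Real.pi * ξ * b) : ℝ) * Complex.I) * 𝓕 f ξ := by
    rw [Real.fourier_real_eq_integral_exp_smul, ← integral_const_mul,
      ← integral_add_right_eq_self (μ := volume) _ b]
    congr 1
    funext t
    rw [add_sub_cancel_right, smul_eq_mul, ← mul_assoc (Complex.exp _) (Complex.exp _), ← Complex.exp_add]
    congr 2
    push_cast
    ring
  rw [h, norm_mul, Complex.norm_exp_ofReal_mul_I, one_mul]

theorem norm_integral_exp_mul_boxHat_le {r : ℕ} (hr : 1 ≤ r) (B : UnitBox d) {ξ : Fin d → ℝ}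
    (hξ : ∀ j, ξ j ≠ 0) :
    ‖∫ x : Fin d → ℝ, Complex.exp (-(2 * Real.pi * Complex.I * ((∑ i, ξ i * x i : ℝ) : ℂ))) *
        (boxHat r B (WithLp.toLp 2 x) : ℂ)‖ ≤
      ∏ j, min ((B.hi j - B.lo j) / r) (Real.pi * |ξ j|)⁻¹ ^ r := by
  rw [integral_exp_mul_boxHat, norm_prod]
  refine Finset.prod_le_prod (fun _ _ => norm_nonneg _) fun j _ => ?_
  rw [norm_integral_exp_mul_translate (fun t => (hat r ((B.hi j - B.lo j) / r) t : ℂ))]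
  exact norm_fourier_hat_le hr (div_pos (sub_pos.2 (B.lo_lt_hi j)) (by positivity)) (hξ j)

end Box

/-! ### Invertibility of a Frolov matrix -/

section Lattice

variable {d : ℕ} {A : Matrix (Fin d) (Fin d) ℝ}

theorem latticePoint_sub (A : Matrix (Fin d) (Fin d) ℝ) (m n : Fin d → ℤ) :
    latticePoint A (m - n) = latticePoint A m - latticePoint A n := by
  rw [latticePoint, latticePoint, latticePoint, ← Matrix.mulVec_sub]
  congr 1
  funext j
  simp

theorem IsFrolovMatrix.latticePoint_ne_zero (hA : IsFrolovMatrix A) {m : Fin d → ℤ} (hm : m ≠ 0)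
    (j : Fin d) : latticePoint A m j ≠ 0 := by
  intro h
  have h1 := hA.one_le_abs_prod m hm
  rw [Finset.prod_eq_zero (Finset.mem_univ j) h, abs_zero] at h1
  linarith

theorem IsFrolovMatrix.latticePoint_injective (hd : 0 < d) (hA : IsFrolovMatrix A) :
    Function.Injective (latticePoint A) := by
  intro m n h
  by_contra hmn
  refine hA.latticePoint_ne_zero (sub_ne_zero.2 hmn) ⟨0, hd⟩ ?_
  rw [latticePoint_sub, h, sub_self, Pi.zero_apply]

/-- Some nonzero multiple of a nonzero vector is arbitrarily close to a nonzero integer vector. -/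
theorem exists_int_near_multiple {v : Fin d → ℝ} (hv : v ≠ 0) {ε : ℝ} (hε : 0 < ε) :
    ∃ m : Fin d → ℤ, m ≠ 0 ∧ ∃ t : ℝ, ‖(fun j => (m j : ℝ)) - t • v‖ < ε := by
  obtain ⟨i, hi⟩ := Function.ne_iff.1 hv
  set w : Fin d → ℝ := (v i)⁻¹ • v with hw
  have hwi : w i = 1 := by simp only [hw, Pi.smul_apply, smul_eq_mul]; exact inv_mul_cancel₀ hi
  -- Dirichlet by compactness: two even multiples of `w` have nearby fractional parts. Since `w i =
  -- 1`, their difference has `i`-th coordinate at least `2`, so an integer vector within distance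
  -- `1` of it is nonzero.
  let x : ℕ → Fin d → ℝ := fun k j => Int.fract ((2 * k : ℝ) * w j)
  have hx (k : ℕ) : x k ∈ Set.Icc (0 : Fin d → ℝ) 1 :=
    ⟨fun j => Int.fract_nonneg _, fun j => (Int.fract_lt_one _).le⟩
  obtain ⟨y, -, φ, hφ, hlim⟩ := tendsto_subseq_of_bounded (Metric.isBounded_Icc _ _) hx
  obtain ⟨N, hN⟩ := Metric.cauchySeq_iff.1 hlim.cauchySeq (min ε 1) (lt_min hε one_pos)
  have hclose := hN N le_rfl (N + 1) (Nat.le_succ N)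
  rw [dist_eq_norm] at hclose
  set p := φ N
  set q := φ (N + 1)
  have hpq : p < q := hφ (Nat.lt_succ_self N)
  let m : Fin d → ℤ := fun j => ⌊(2 * q : ℝ) * w j⌋ - ⌊(2 * p : ℝ) * w j⌋
  have hdiff : (fun j => (m j : ℝ)) - (2 * (q - p) : ℝ) • w = x p - x q := by
    funext j
    simp only [m, x, Int.fract, Pi.sub_apply, Pi.smul_apply, smul_eq_mul]
    push_cast
    ring
  have hnorm : ‖(fun j => (m j : ℝ)) - (2 * (q - p) : ℝ) • w‖ < min ε 1 := by
    rw [hdiff]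
    exact hclose
  refine ⟨m, fun h0 => ?_, 2 * (q - p) * (v i)⁻¹, ?_⟩
  · have h1 := (norm_le_pi_norm _ i).trans_lt (hnorm.trans_le (min_le_right _ _))
    have h2 : (p : ℝ) + 1 ≤ q := by exact_mod_cast hpq
    simp only [h0, Pi.sub_apply, Pi.zero_apply, Int.cast_zero, Pi.smul_apply, smul_eq_mul, hwi,
      mul_one, zero_sub, norm_neg, Real.norm_eq_abs] at h1
    rw [abs_of_pos (by linarith)] at h1
    linarith
  · rw [mul_smul]
    exact hnorm.trans_le (min_le_left _ _)

/-- A kernel line would pass close to a nonzero integer vector, whose image would have all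
coordinates below `1` in absolute value, against the product property. -/
theorem IsFrolovMatrix.det_ne_zero (hd : 0 < d) (hA : IsFrolovMatrix A) : A.det ≠ 0 := by
  intro hdet
  obtain ⟨v, hv, hAv⟩ := Matrix.exists_mulVec_eq_zero_iff.2 hdet
  have hcont : ContinuousAt (fun x : Fin d → ℝ => A.mulVec x) 0 := by
    refine Continuous.continuousAt ?_
    fun_prop
  obtain ⟨ε, hε, hb⟩ := Metric.continuousAt_iff.1 hcont 1 one_pos
  obtain ⟨m, hm, t, ht⟩ := exists_int_near_multiple hv hε
  have h1 := hb (x := (fun j => (m j : ℝ)) - t • v) (by rwa [dist_zero_right])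
  rw [Matrix.mulVec_zero, dist_zero_right, Matrix.mulVec_sub, Matrix.mulVec_smul, hAv, smul_zero,
    sub_zero] at h1
  have h2 (j : Fin d) : |latticePoint A m j| < 1 := (norm_le_pi_norm _ j).trans_lt h1
  have h3 := hA.one_le_abs_prod m hm
  rw [Finset.abs_prod] at h3
  have : ∏ j : Fin d, |latticePoint A m j| < ∏ _j : Fin d, (1 : ℝ) :=
    Finset.prod_lt_prod_of_nonempty (fun j _ => abs_pos.2 (hA.latticePoint_ne_zero hm j))
      (fun j _ => h2 j) ⟨⟨0, hd⟩, Finset.mem_univ _⟩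
  rw [Finset.prod_const_one] at this
  linarith

end Lattice

/-! ### The cubature formula as a sum over the dual lattice -/

section Cubature

variable {d : ℕ} {A : Matrix (Fin d) (Fin d) ℝ}

theorem integral_comp_mulVec {M : Matrix (Fin d) (Fin d) ℝ} (hM : M.det ≠ 0)
    {φ : (Fin d → ℝ) → ℂ} (hφ : Continuous φ) :
    ∫ x, φ (M.mulVec x) = (|M.det|⁻¹ : ℝ) * ∫ y, φ y := by
  have h := Real.map_matrix_volume_pi_eq_smul_volume_pi hM
  have hm : AEMeasurable (Matrix.toLin' M) volume :=
    (LinearMap.continuous_of_finiteDimensional _).measurable.aemeasurable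
  have h1 := integral_map hm (f := φ) hφ.aestronglyMeasurable
  rw [h, integral_smul_measure, ENNReal.toReal_ofReal (abs_nonneg _), abs_inv] at h1
  rw [← Complex.real_smul, h1]
  rfl

/-- Poisson summation for the Frolov cubature formula. -/
theorem hasSum_cubature (hdet : A.det ≠ 0) {a : ℝ} (ha : 0 < a)
    {f : EuclideanSpace ℝ (Fin d) → ℝ} (hf : Continuous f)
    (hs : HasCompactSupport fun x : Fin d → ℝ => f (WithLp.toLp 2 x))
    (hsum : Summable fun n : Fin d → ℤ => ∫ x : Fin d → ℝ,
      Complex.exp (-(2 * Real.pi * Complex.I * ((∑ i, (a * latticePoint A n i) * x i : ℝ) : ℂ))) *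
        (f (WithLp.toLp 2 x) : ℂ)) :
    HasSum (fun n : Fin d → ℤ => ∫ x : Fin d → ℝ,
      Complex.exp (-(2 * Real.pi * Complex.I * ((∑ i, (a * latticePoint A n i) * x i : ℝ) : ℂ))) *
        (f (WithLp.toLp 2 x) : ℂ)) (cubature a A f : ℂ) := by
  -- `M` carries `ℤ^d` to the nodes and `|det M|` is the cubature weight; its inverse transpose `a
  -- A` acts on the frequencies.
  set M : Matrix (Fin d) (Fin d) ℝ := a⁻¹ • (A⁻¹).transpose with hM
  have hdM : |M.det| = (a ^ d * |A.det|)⁻¹ := by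
    rw [hM, Matrix.det_smul, Matrix.det_transpose, Matrix.det_nonsing_inv, Ring.inverse_eq_inv',
      abs_mul, abs_inv, Fintype.card_fin, mul_inv, inv_pow, abs_of_pos (by positivity)]
  have hM0 : M.det ≠ 0 := by
    rw [← abs_ne_zero, hdM]
    exact inv_ne_zero (mul_ne_zero (pow_ne_zero _ ha.ne') (abs_ne_zero.2 hdet))
  have hcoef (n : Fin d → ℤ) :
      ∫ x : Fin d → ℝ, Complex.exp (-(2 * Real.pi * Complex.I * ((∑ i, n i * x i : ℝ) : ℂ))) *
        (f (WithLp.toLp 2 (M.mulVec x)) : ℂ) = (|M.det|⁻¹ : ℝ) * ∫ x : Fin d → ℝ,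
      Complex.exp (-(2 * Real.pi * Complex.I * ((∑ i, (a * latticePoint A n i) * x i : ℝ) : ℂ))) *
        (f (WithLp.toLp 2 x) : ℂ) := by
    rw [← integral_comp_mulVec hM0 (by fun_prop)]
    congr 1
    funext x
    have : ∑ i, (a * latticePoint A n i) * M.mulVec x i = ∑ i, (n i : ℝ) * x i := by
      change (a • latticePoint A n) ⬝ᵥ M.mulVec x = (fun i => (n i : ℝ)) ⬝ᵥ x
      rw [hM, Matrix.smul_mulVec, smul_dotProduct, dotProduct_smul, smul_smul, mul_inv_cancel₀ ha.ne',
        one_smul, Matrix.dotProduct_mulVec, Matrix.vecMul_transpose, latticePoint,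
        Matrix.mulVec_mulVec, Matrix.nonsing_inv_mul _ (isUnit_iff_ne_zero.2 hdet),
        Matrix.one_mulVec]
    rw [this]
  let e : (Fin d → ℝ) ≃ₜ (Fin d → ℝ) :=
    (LinearEquiv.toContinuousLinearEquiv
      (Matrix.toLinearEquiv' M (M.invertibleOfIsUnitDet (isUnit_iff_ne_zero.2 hM0)))).toHomeomorph
  have hsM : HasCompactSupport fun x : Fin d → ℝ => f (WithLp.toLp 2 (M.mulVec x)) :=
    hs.comp_homeomorph e
  have hP := hasSum_fourier_int (g := fun x : Fin d → ℝ => (f (WithLp.toLp 2 (M.mulVec x)) : ℂ))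
    (by fun_prop) (hsM.comp_left Complex.ofReal_zero)
  simp only [hcoef] at hP
  have hP' := (hP (hsum.mul_left _)).mul_left ((|M.det| : ℝ) : ℂ)
  have hc : ((|M.det| : ℝ) : ℂ) * ((|M.det|⁻¹ : ℝ) : ℂ) = 1 := by
    rw [← Complex.ofReal_mul, mul_inv_cancel₀ (abs_ne_zero.2 hM0), Complex.ofReal_one]
  simp only [← mul_assoc, hc, one_mul] at hP'
  have hcub : cubature a A f =
      |M.det| * ∑' m : Fin d → ℤ, f (WithLp.toLp 2 (M.mulVec fun j => (m j : ℝ))) := by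
    rw [hdM]
    simp only [hM, Matrix.smul_mulVec]
    rfl
  rwa [hcub, Complex.ofReal_mul, Complex.ofReal_tsum]

end Cubature

/-! ### Dyadic counting of lattice points -/

section Counting

/-- The dyadic level of a nonnegative real: the least `s` with `x < 2 ^ s`. -/
noncomputable def dyadicLevel (x : ℝ) : ℕ := Nat.size ⌊x⌋₊

theorem lt_two_pow_dyadicLevel {x : ℝ} (hx : 0 ≤ x) : x < 2 ^ dyadicLevel x := by
  have h : ⌊x⌋₊ < 2 ^ dyadicLevel x := Nat.lt_size_self _
  exact_mod_cast (Nat.floor_lt hx).1 h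

theorem dyadicLevel_le {x : ℝ} (hx : 0 ≤ x) {n : ℕ} (h : x < 2 ^ n) : dyadicLevel x ≤ n :=
  Nat.size_le.2 ((Nat.floor_lt hx).2 (by exact_mod_cast h))

theorem two_pow_le_of_lt_dyadicLevel {x : ℝ} (hx : 0 ≤ x) {n : ℕ} (h : n < dyadicLevel x) :
    (2 : ℝ) ^ n ≤ x := by
  by_contra! h'
  exact absurd (dyadicLevel_le hx h') (not_le.2 h)

/-- At level `0` the bound `w` suffices. At level `n + 1` one only knows `2 ^ n ≤ w * |l|`, and the
missing factor `2` is supplied by `2 ≤ π`. -/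
theorem min_inv_le_mul_inv_two_pow {w l : ℝ} (hw : 0 < w) (hl : l ≠ 0) :
    min w (Real.pi * |l|)⁻¹ ≤ w * (2 ^ dyadicLevel (w * |l|))⁻¹ := by
  have hl' : 0 < |l| := abs_pos.2 hl
  rcases Nat.eq_zero_or_pos (dyadicLevel (w * |l|)) with h | h
  · rw [h, pow_zero, inv_one, mul_one]
    exact min_le_left _ _
  · obtain ⟨n, hn⟩ := Nat.exists_eq_add_of_le' h
    have h2 := two_pow_le_of_lt_dyadicLevel (mul_pos hw hl').le (n := n) (by omega)
    refine (min_le_right _ _).trans ?_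
    rw [hn, ← div_eq_mul_inv, inv_le_comm₀ (by positivity) (by positivity), inv_div,
      div_le_iff₀ hw, pow_succ]
    have h3 : w * |l| * 2 ≤ w * |l| * Real.pi :=
      mul_le_mul_of_nonneg_left Real.two_le_pi (by positivity)
    linarith

/-- The prescribed sum recovers the first coordinate from the remaining `d - 1`, each of which lies
in `[0, n]`. -/
theorem card_piAntidiag_le (d n : ℕ) :
    (Finset.piAntidiag (Finset.univ : Finset (Fin d)) n).card ≤ (n + 1) ^ (d - 1) := by
  classical
  rcases d with _ | e
  · refine Finset.card_le_one.2 fun a _ b _ => Subsingleton.elim a b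
  · have hle (s : Fin (e + 1) → ℕ) (hs : s ∈ Finset.piAntidiag Finset.univ n) (j) : s j ≤ n := by
      rw [← (Finset.mem_piAntidiag.1 hs).1]
      exact Finset.single_le_sum (fun _ _ => Nat.zero_le _) (Finset.mem_univ j)
    have := Finset.card_le_card_of_injOn (s := Finset.piAntidiag (Finset.univ : Finset (Fin (e + 1))) n)
      (t := Fintype.piFinset fun _ : Fin e => Finset.range (n + 1)) (fun s => Fin.tail s) ?_ ?_
    · simpa using this
    · intro s hs
      simp only [Finset.mem_coe, Fintype.mem_piFinset, Finset.mem_range]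
      exact fun j => Nat.lt_succ_of_le (hle s hs _)
    · intro s hs t ht hst
      have h1 := (Finset.mem_piAntidiag.1 hs).1
      have h2 := (Finset.mem_piAntidiag.1 ht).1
      rw [Fin.sum_univ_succ] at h1 h2
      have htail (j : Fin e) : s j.succ = t j.succ := congrFun hst j
      simp only [htail] at h1
      funext j
      refine Fin.cases (by omega) htail j

theorem summable_succ_pow_mul_half_pow (e : ℕ) :
    Summable fun k : ℕ => ((k : ℝ) + 1) ^ e * (1 / 2) ^ k := by
  have h := summable_pow_mul_geometric_of_norm_lt_one (R := ℝ) e (r := 1 / 2) (by norm_num)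
  have h' := ((summable_nat_add_iff 1).2 h).mul_left 2
  refine h'.congr fun k => ?_
  push_cast
  ring

variable {d : ℕ} {A : Matrix (Fin d) (Fin d) ℝ} {w : Fin d → ℝ}

/-- The vector of dyadic levels of a lattice point with respect to the scaling `w`. -/
noncomputable def levels (A : Matrix (Fin d) (Fin d) ℝ) (w : Fin d → ℝ) (m : Fin d → ℤ) :
    Fin d → ℕ :=
  fun j => dyadicLevel (w j * |latticePoint A m j|)

/-- The product property enters the counting here: it rules out all small level sums, giving the
starting point of the geometric series. -/
theorem IsFrolovMatrix.prod_lt_two_pow (hd : 0 < d) (hA : IsFrolovMatrix A) (hw : ∀ j, 0 < w j)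
    {m : Fin d → ℤ} (hm : m ≠ 0) : ∏ j, w j < 2 ^ ∑ j, levels A w m j := by
  have h1 : ∏ j, w j ≤ ∏ j, w j * |latticePoint A m j| := by
    rw [Finset.prod_mul_distrib, ← Finset.abs_prod]
    exact le_mul_of_one_le_right (Finset.prod_nonneg fun j _ => (hw j).le) (hA.one_le_abs_prod m hm)
  refine h1.trans_lt ?_
  rw [← Finset.prod_pow_eq_pow_sum]
  have hpos (j : Fin d) : 0 < w j * |latticePoint A m j| :=
    mul_pos (hw j) (abs_pos.2 (hA.latticePoint_ne_zero hm j))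
  exact Finset.prod_lt_prod_of_nonempty (fun j _ => hpos j)
    (fun j _ => lt_two_pow_dyadicLevel (hpos j).le) ⟨⟨0, hd⟩, Finset.mem_univ _⟩

theorem IsFrolovMatrix.prod_min_le (hA : IsFrolovMatrix A) (hw : ∀ j, 0 < w j) (r : ℕ)
    {m : Fin d → ℤ} (hm : m ≠ 0) :
    ∏ j, min (w j) (Real.pi * |latticePoint A m j|)⁻¹ ^ r ≤
      ((∏ j, w j) / 2 ^ ∑ j, levels A w m j) ^ r := by
  rw [Finset.prod_pow, div_eq_mul_inv, ← Finset.prod_pow_eq_pow_sum, ← Finset.prod_inv_distrib,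
    ← Finset.prod_mul_distrib]
  have h0 (j : Fin d) : 0 ≤ min (w j) (Real.pi * |latticePoint A m j|)⁻¹ :=
    le_min (hw j).le (by positivity)
  exact pow_le_pow_left₀ (Finset.prod_nonneg fun j _ => h0 j) (Finset.prod_le_prod (fun j _ => h0 j)
    fun j _ => min_inv_le_mul_inv_two_pow (hw j) (hA.latticePoint_ne_zero hm j)) _

/-- All these points lie in the symmetric box with half-widths `2 ^ σ j / w j`, to which the box
count applies. -/
theorem IsFrolovMatrix.card_levels_le (hd : 0 < d) (hA : IsFrolovMatrix A) (hw : ∀ j, 0 < w j)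
    (σ : Fin d → ℕ) (S : Finset (Fin d → ℤ)) (hS : ∀ m ∈ S, levels A w m = σ) :
    (S.card : ℝ) ≤ 2 ^ d * (2 ^ ∑ j, σ j) / (∏ j, w j) + 1 := by
  classical
  obtain ⟨hfin, hcard⟩ := hA.box_count (fun j => -(2 ^ σ j / w j)) (fun j => 2 ^ σ j / w j)
    fun j => by have : 0 < 2 ^ σ j / w j := div_pos (by positivity) (hw j)
                linarith
  have hprod : ∏ j, (2 ^ σ j / w j - -(2 ^ σ j / w j)) = 2 ^ d * (2 ^ ∑ j, σ j) / (∏ j, w j) := by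
    rw [← Finset.prod_pow_eq_pow_sum, mul_div_assoc, ← Finset.prod_div_distrib]
    simp only [sub_neg_eq_add, ← two_mul]
    rw [Finset.prod_mul_distrib, Finset.prod_const, Finset.card_univ, Fintype.card_fin]
  rw [hprod] at hcard
  refine le_trans ?_ hcard
  rw [← Finset.card_image_of_injective S (hA.latticePoint_injective hd), ← Set.ncard_coe_finset]
  refine Nat.cast_le.2 (Set.ncard_le_ncard ?_ hfin)
  intro x hx
  obtain ⟨m, hm, rfl⟩ := Finset.mem_image.1 (Finset.mem_coe.1 hx)
  refine ⟨⟨m, rfl⟩, ?_⟩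
  have h (j : Fin d) : |latticePoint A m j| ≤ 2 ^ σ j / w j := by
    rw [le_div_iff₀ (hw j), mul_comm, ← hS m hm]
    exact (lt_two_pow_dyadicLevel (mul_nonneg (hw j).le (abs_nonneg _))).le
  exact ⟨fun j => (abs_le.1 (h j)).1, fun j => (abs_le.1 (h j)).2⟩

/-- With `q = W / 2 ^ ∑ σ j ≤ 1`, the number of points is at most `2 ^ d / q + 1` and each term at
most `q ^ r ≤ q ^ 2`: one factor `q` pays for the count, the other is the decay. This is where `2 ≤
r` matters. -/
theorem IsFrolovMatrix.sum_levels_le (hd : 0 < d) (hA : IsFrolovMatrix A) (hw : ∀ j, 0 < w j)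
    {r : ℕ} (hr : 2 ≤ r) (σ : Fin d → ℕ) (S : Finset (Fin d → ℤ)) (h0 : ∀ m ∈ S, m ≠ 0)
    (hS : ∀ m ∈ S, levels A w m = σ) :
    ∑ m ∈ S, ∏ j, min (w j) (Real.pi * |latticePoint A m j|)⁻¹ ^ r ≤
      (2 ^ d + 1) * ((∏ j, w j) / 2 ^ ∑ j, σ j) := by
  have hW : 0 < ∏ j, w j := Finset.prod_pos fun j _ => hw j
  set W := ∏ j, w j with hWdef
  set q := W / 2 ^ ∑ j, σ j with hq
  have hq0 : 0 < q := by positivity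
  rcases S.eq_empty_or_nonempty with rfl | ⟨m₀, hm₀⟩
  · rw [Finset.sum_empty]
    positivity
  have hq1 : q ≤ 1 := by
    have := hA.prod_lt_two_pow hd hw (h0 m₀ hm₀)
    rw [hS m₀ hm₀] at this
    exact (div_le_one (by positivity)).2 this.le
  have h1 : ∑ m ∈ S, ∏ j, min (w j) (Real.pi * |latticePoint A m j|)⁻¹ ^ r ≤ S.card • q ^ r := by
    refine Finset.sum_le_card_nsmul _ _ _ fun m hm => ?_
    have := hA.prod_min_le hw r (h0 m hm)
    rwa [hS m hm] at this
  have h2 : (S.card : ℝ) * q ≤ 2 ^ d + 1 := by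
    have h := mul_le_mul_of_nonneg_right (hA.card_levels_le hd hw σ S hS) hq0.le
    have h3 : (2 ^ d * (2 ^ ∑ j, σ j) / W + 1) * q = 2 ^ d + q := by
      rw [hq]
      field_simp
    rw [← hWdef, h3] at h
    linarith
  have h3 : q ^ r ≤ q * q := by
    rw [← pow_two]
    exact pow_le_pow_of_le_one hq0.le hq1 hr
  calc _ ≤ S.card • q ^ r := h1
    _ = S.card * q ^ r := nsmul_eq_mul _ _
    _ ≤ S.card * (q * q) := by gcongr
    _ = (S.card * q) * q := by ring
    _ ≤ (2 ^ d + 1) * q := by gcongr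

theorem IsFrolovMatrix.sum_level_sum_le (hd : 0 < d) (hA : IsFrolovMatrix A) (hw : ∀ j, 0 < w j)
    {r : ℕ} (hr : 2 ≤ r) (n : ℕ) (S : Finset (Fin d → ℤ)) (h0 : ∀ m ∈ S, m ≠ 0)
    (hS : ∀ m ∈ S, ∑ j, levels A w m j = n) :
    ∑ m ∈ S, ∏ j, min (w j) (Real.pi * |latticePoint A m j|)⁻¹ ^ r ≤
      (n + 1) ^ (d - 1) * ((2 ^ d + 1) * ((∏ j, w j) / 2 ^ n)) := by
  classical
  have hW : 0 < ∏ j, w j := Finset.prod_pos fun j _ => hw j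
  rw [← Finset.sum_fiberwise_of_maps_to (s := S) (t := Finset.piAntidiag Finset.univ n)
    (g := levels A w) (fun m hm => Finset.mem_piAntidiag.2 ⟨hS m hm, by simp⟩)]
  refine (Finset.sum_le_card_nsmul _ _ ((2 ^ d + 1) * ((∏ j, w j) / 2 ^ n)) fun σ hσ => ?_).trans ?_
  · have := hA.sum_levels_le hd hw hr σ (S.filter fun m => levels A w m = σ)
      (fun m hm => h0 m (Finset.mem_filter.1 hm).1) (fun m hm => (Finset.mem_filter.1 hm).2)
    rwa [(Finset.mem_piAntidiag.1 hσ).1] at this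
  · rw [nsmul_eq_mul]
    refine mul_le_mul_of_nonneg_right ?_ (by positivity)
    exact_mod_cast card_piAntidiag_le d n

theorem IsFrolovMatrix.sum_prod_min_le (hd : 0 < d) (hA : IsFrolovMatrix A) (hw : ∀ j, 0 < w j)
    {r : ℕ} (hr : 2 ≤ r) (S : Finset (Fin d → ℤ)) (h0 : ∀ m ∈ S, m ≠ 0) :
    ∑ m ∈ S, ∏ j, min (w j) (Real.pi * |latticePoint A m j|)⁻¹ ^ r ≤
      (2 ^ d + 1) * (∑' k : ℕ, ((k : ℝ) + 1) ^ (d - 1) * (1 / 2) ^ k) *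
        ((dyadicLevel (∏ j, w j) : ℝ) + 1) ^ (d - 1) := by
  classical
  have hW : 0 < ∏ j, w j := Finset.prod_pos fun j _ => hw j
  set W := ∏ j, w j with hWdef
  set n₀ := dyadicLevel W
  set N : (Fin d → ℤ) → ℕ := fun m => ∑ j, levels A w m j with hN
  have hge (n : ℕ) (hn : n ∈ S.image N) : n₀ ≤ n := by
    obtain ⟨m, hm, rfl⟩ := Finset.mem_image.1 hn
    exact dyadicLevel_le hW.le (hA.prod_lt_two_pow hd hw (h0 m hm))
  have hn₀ : W < 2 ^ n₀ := lt_two_pow_dyadicLevel hW.le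
  set g : ℕ → ℝ := fun k => ((k : ℝ) + 1) ^ (d - 1) * (1 / 2) ^ k with hg
  rw [← Finset.sum_fiberwise_of_maps_to (s := S) (t := S.image N) (g := N)
    (fun m hm => Finset.mem_image_of_mem N hm)]
  have hstep (n : ℕ) (hn : n ∈ S.image N) :
      ∑ m ∈ S with N m = n, ∏ j, min (w j) (Real.pi * |latticePoint A m j|)⁻¹ ^ r ≤
        (2 ^ d + 1) * ((n₀ : ℝ) + 1) ^ (d - 1) * g (n - n₀) := by
    obtain ⟨k, rfl⟩ := Nat.exists_eq_add_of_le (hge n hn)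
    refine (hA.sum_level_sum_le hd hw hr _ _ (fun m hm => h0 m (Finset.mem_filter.1 hm).1)
      (fun m hm => (Finset.mem_filter.1 hm).2)).trans ?_
    have h1 : W / 2 ^ (n₀ + k) ≤ (1 / 2) ^ k := by
      rw [pow_add, div_le_iff₀ (by positivity), one_div, inv_pow, mul_comm ((2 : ℝ) ^ n₀),
        inv_mul_cancel_left₀ (by positivity)]
      exact hn₀.le
    -- Splitting `n₀ + k + 1 ≤ (n₀ + 1)(k + 1)` separates the logarithmic factor from a convergent
    -- series independent of `W`.
    have h2 : (((n₀ + k : ℕ) : ℝ) + 1) ^ (d - 1) ≤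
        ((n₀ : ℝ) + 1) ^ (d - 1) * ((k : ℝ) + 1) ^ (d - 1) := by
      rw [← mul_pow]
      refine pow_le_pow_left₀ (by positivity) ?_ _
      push_cast
      have : (0 : ℝ) ≤ n₀ * k := by positivity
      linarith
    rw [Nat.add_sub_cancel_left]
    calc _ ≤ (((n₀ : ℝ) + 1) ^ (d - 1) * ((k : ℝ) + 1) ^ (d - 1)) *
          ((2 ^ d + 1) * (1 / 2) ^ k) := by gcongr
      _ = _ := by rw [hg]; ring
  refine (Finset.sum_le_sum hstep).trans ?_
  rw [← Finset.mul_sum, mul_right_comm]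
  refine mul_le_mul_of_nonneg_right ?_ (by positivity)
  refine mul_le_mul_of_nonneg_left ?_ (by positivity)
  have hinj : Set.InjOn (fun n => n - n₀) (S.image N : Set ℕ) := by
    intro a ha b hb hab
    have h1 := hge a ha
    have h2 := hge b hb
    simp only at hab
    omega
  rw [← Finset.sum_image (f := g) hinj]
  exact (summable_succ_pow_mul_half_pow (d - 1)).sum_le_tsum _ fun k _ => by positivity

/-- For level `n + 1` one has `n log 2 ≤ log x`, and `n + 2 ≤ 2 (n + 1)`; the `2` inside the
logarithm keeps the bound valid at `x = 1`. -/
theorem dyadicLevel_add_one_le {x : ℝ} (hx : 1 ≤ x) :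
    (dyadicLevel x : ℝ) + 1 ≤ 2 / Real.log 2 * Real.log (2 * x) := by
  have hpos : 0 < dyadicLevel x := by
    by_contra h
    have := lt_two_pow_dyadicLevel (zero_le_one.trans hx)
    rw [Nat.eq_zero_of_not_pos h, pow_zero] at this
    linarith
  obtain ⟨n, hn⟩ := Nat.exists_eq_add_of_le' hpos
  have h2 := two_pow_le_of_lt_dyadicLevel (zero_le_one.trans hx) (n := n) (by omega)
  have h3 := Real.log_le_log (by positivity) h2
  have hl : 0 < Real.log 2 := Real.log_pos one_lt_two
  rw [Real.log_pow] at h3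
  rw [hn, div_mul_eq_mul_div, le_div_iff₀ hl, Real.log_mul two_ne_zero (by positivity)]
  have h4 := Real.log_nonneg hx
  push_cast
  linarith

end Counting

/-! ### Assembling the error bound -/

/-- The dual-lattice form of the cubature error bound. -/
theorem IsFrolovMatrix.norm_cubature_boxHat_sub_le {d : ℕ} (hd : 0 < d)
    {A : Matrix (Fin d) (Fin d) ℝ} (hA : IsFrolovMatrix A) {r : ℕ} (hr : 2 ≤ r) {a : ℝ} (ha : 0 < a)
    (B : UnitBox d) :
    ‖(cubature a A (boxHat r B) : ℂ)
        - 𝓕 (fun x : EuclideanSpace ℝ (Fin d) => (boxHat r B x : ℂ)) 0‖ ≤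
      (a ^ (r * d))⁻¹ * ((2 ^ d + 1) * (∑' k : ℕ, ((k : ℝ) + 1) ^ (d - 1) * (1 / 2) ^ k) *
        ((dyadicLevel (∏ j, a * ((B.hi j - B.lo j) / r)) : ℝ) + 1) ^ (d - 1)) := by
  classical
  set w : Fin d → ℝ := fun j => a * ((B.hi j - B.lo j) / r) with hw
  have hw0 (j : Fin d) : 0 < w j :=
    mul_pos ha (div_pos (sub_pos.2 (B.lo_lt_hi j)) (by positivity))
  set K := (2 ^ d + 1) * (∑' k : ℕ, ((k : ℝ) + 1) ^ (d - 1) * (1 / 2) ^ k) *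
        ((dyadicLevel (∏ j, w j) : ℝ) + 1) ^ (d - 1)
  set F : (Fin d → ℤ) → ℂ := fun n => ∫ x : Fin d → ℝ,
    Complex.exp (-(2 * Real.pi * Complex.I * ((∑ i, (a * latticePoint A n i) * x i : ℝ) : ℂ))) *
      (boxHat r B (WithLp.toLp 2 x) : ℂ) with hF
  have hbound (n : Fin d → ℤ) (hn : n ≠ 0) : ‖F n‖ ≤
      (a ^ (r * d))⁻¹ * ∏ j, min (w j) (Real.pi * |latticePoint A n j|)⁻¹ ^ r := by
    refine (norm_integral_exp_mul_boxHat_le (by omega) B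
      fun j => mul_ne_zero ha.ne' (hA.latticePoint_ne_zero hn j)).trans_eq ?_
    have h1 (j : Fin d) : min ((B.hi j - B.lo j) / r) (Real.pi * |a * latticePoint A n j|)⁻¹ =
        a⁻¹ * min (w j) (Real.pi * |latticePoint A n j|)⁻¹ := by
      rw [mul_min_of_nonneg _ _ (inv_pos.2 ha).le, hw, inv_mul_cancel_left₀ ha.ne', abs_mul,
        abs_of_pos ha, ← mul_inv]
      congr 2
      ring
    simp only [h1, mul_pow]
    rw [Finset.prod_mul_distrib, Finset.prod_const, Finset.card_univ, Fintype.card_fin, ← pow_mul,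
      inv_pow]
  -- The uniform bound on finite partial sums of `G` gives both the summability needed for Poisson
  -- summation and the final estimate.
  let G : (Fin d → ℤ) → ℝ := fun n => if n = 0 then 0 else
    (a ^ (r * d))⁻¹ * ∏ j, min (w j) (Real.pi * |latticePoint A n j|)⁻¹ ^ r
  have hG0 (n : Fin d → ℤ) : 0 ≤ G n := by
    have (j : Fin d) : 0 ≤ min (w j) (Real.pi * |latticePoint A n j|)⁻¹ :=
      le_min (hw0 j).le (by positivity)
    simp only [G]
    split_ifs
    · exact le_rfl
    · exact mul_nonneg (by positivity) (Finset.prod_nonneg fun j _ => pow_nonneg (this j) _)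
  have hGsum (S : Finset (Fin d → ℤ)) : ∑ n ∈ S, G n ≤ (a ^ (r * d))⁻¹ * K := by
    have h1 : ∑ n ∈ S, G n = (a ^ (r * d))⁻¹ * ∑ n ∈ S with n ≠ 0,
        ∏ j, min (w j) (Real.pi * |latticePoint A n j|)⁻¹ ^ r := by
      rw [Finset.mul_sum, Finset.sum_filter]
      refine Finset.sum_congr rfl fun n _ => ?_
      simp only [G, ne_eq, ite_not]
    rw [h1]
    refine mul_le_mul_of_nonneg_left ?_ (by positivity)
    exact hA.sum_prod_min_le hd hw0 hr _ fun n hn => (Finset.mem_filter.1 hn).2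
  have hGs : Summable G := summable_of_sum_le hG0 hGsum
  have hFG (n : Fin d → ℤ) : ‖if n = 0 then 0 else F n‖ ≤ G n := by
    simp only [G]
    split_ifs with h
    · simp
    · exact hbound n h
  have hFs : Summable F := by
    have h := (Summable.of_norm_bounded hGs hFG).update 0 (F 0)
    refine h.congr fun n => ?_
    by_cases hn : n = 0
    · simp [hn]
    · simp [hn]
  have hP := (hasSum_cubature (hA.det_ne_zero hd) ha (continuous_boxHat hr B)
    (hasCompactSupport_boxHat_toLp (by omega) B) hFs).tsum_eq
  have hF0 : F 0 = 𝓕 (fun x : EuclideanSpace ℝ (Fin d) => (boxHat r B x : ℂ)) 0 := by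
    rw [fourier_boxHat_zero]
    simp [hF, latticePoint, Matrix.mulVec, dotProduct]
  rw [← hP, ← hF0, hFs.tsum_eq_add_tsum_ite 0, add_sub_cancel_left]
  exact (tsum_of_norm_bounded hGs.hasSum hFG).trans (Real.tsum_le_of_sum_le hG0 hGsum)

end FrolovSmooth

theorem mainTheorem9 (d : ℕ) (hd : 2 ≤ d) (A : Matrix (Fin d) (Fin d) ℝ)
    (hA : FrolovSmooth.IsFrolovMatrix A) (r : ℕ) (hr : 2 ≤ r) :
    ∃ c C : ℝ, 0 < c ∧ 0 < C ∧
      ∀ a : ℝ, 1 < a → ∀ V₀ : ℝ, V₀ = c * a ^ (-(d : ℤ)) →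
        ∀ V : ℝ, V₀ ≤ V → ∀ B : FrolovSmooth.UnitBox d, B.vol = V →
          ‖((FrolovSmooth.cubature a A (FrolovSmooth.boxHat r B) : ℝ) : ℂ)
              - 𝓕 (fun x : EuclideanSpace ℝ (Fin d) => (FrolovSmooth.boxHat r B x : ℂ)) 0‖
            ≤ C * a ^ (-((r : ℤ) * (d : ℤ))) * Real.log (2 * V / V₀) ^ (d - 1) := by
  set κ : ℝ := ∑' k : ℕ, ((k : ℝ) + 1) ^ (d - 1) * (1 / 2) ^ k with hκ
  have hκ0 : 0 < κ :=
    (FrolovSmooth.summable_succ_pow_mul_half_pow (d - 1)).tsum_pos (fun k => by positivity) 0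
      (by simp)
  have hl : 0 < Real.log 2 := Real.log_pos one_lt_two
  -- With `c = r ^ d` the product of the rescaled widths `a (hi - lo) / r` is exactly `V / V₀`, so
  -- `V₀ ≤ V` becomes `1 ≤ W`.
  refine ⟨r ^ d, (2 ^ d + 1) * κ * (2 / Real.log 2) ^ (d - 1), by positivity, by positivity, ?_⟩
  rintro a ha V₀ hV₀ V hV B rfl
  have ha0 : 0 < a := one_pos.trans ha
  have hV₀pos : 0 < V₀ := by rw [hV₀]; positivity
  have hW : ∏ j, a * ((B.hi j - B.lo j) / r) = B.vol / V₀ := by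
    rw [B.vol_eq_prod, hV₀, zpow_neg, zpow_natCast, Finset.prod_mul_distrib,
      Finset.prod_div_distrib, Finset.prod_const, Finset.prod_const, Finset.card_univ,
      Fintype.card_fin]
    field_simp
  refine (hA.norm_cubature_boxHat_sub_le (by omega) hr ha0 B).trans ?_
  rw [hW, ← hκ]
  have h1 := FrolovSmooth.dyadicLevel_add_one_le ((one_le_div hV₀pos).2 hV)
  have hz : a ^ (-((r : ℤ) * (d : ℤ))) = (a ^ (r * d))⁻¹ := by
    rw [zpow_neg, ← Nat.cast_mul, zpow_natCast]
  rw [hz, mul_div_assoc 2]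
  calc _ ≤ (a ^ (r * d))⁻¹ * ((2 ^ d + 1) * κ *
        (2 / Real.log 2 * Real.log (2 * (B.vol / V₀))) ^ (d - 1)) := by gcongr
    _ = _ := by rw [mul_pow]; ring
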